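/- Let $G=\{0,1\}^{\mathbb N}$ be the Walsh group with its normalized Haar (product) measure $\mu$, and write $E$ for the integral with respect to $\mu$. Let $r_k(x)=(-1)^{x_k}$ be the Rademacher functions and $w_m=\prod_k r_k^{m_k}$ (where $m=\sum_k m_k2^k$, $m_k\in\{0,1\}$) the Walsh--Paley functions, and let $\widehat f(k)=E(fw_k)$ for $f\in L_1(G)$. For $t\in[0,1)$ let $t=\sum_{j\ge0}t_j2^{-j-1}$ be its binary expansion (the one terminating in zeros if $t$ is a dyadic rational). Put $\beta_0(t)=(-1)^{t_0}$, $\beta_k(t)=(-1)^{t_n}$ for $2^{n-1}\le k<2^n$, $n\ge1$, and $$\widetilde S^{(t)}_nf=\sum_{k=0}^{n-1}\beta_k(t)\widehat f(k)w_k,\qquad \widetilde\sigma^{(t)}_nf=\frac1n\sum_{k=0}^{n-1}\widetilde S^{(t)}_kf\quad(n\ge1).$$ A Young function is a convex, continuous, even function $Q:\mathbb R\to\mathbb R$ with $Q(0)=0$, $Q(u)/u\to\infty$ as $u\to+\infty$ and $Q(u)/u\to0$ as $u\to0$. The Orlicz space $Q(L)$ consists of the measurable functions $f:G\to\mathbb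 R$ for which the norm $\|f\|_{Q(L)}=\inf\{k>0:E\,Q(|f|/k)\le1\}$ is finite; $L\log L$ is the Orlicz space of $Q(u)=|u|\log(1+|u|)$. (i) Let $t\in[0,1)$ be a dyadic irrational (that is, not of the form $p/2^n$ with integers $p,n\ge0$), and let $Q$ be a Young function with $Q(L)\not\subseteq L\log L$. Then every $\widetilde\sigma^{(t)}_{2^A}$, $A\in\mathbb N$, is bounded from $Q(L)$ to $L_1$, but $$\sup_{A\in\mathbb N}\bigl\|\widetilde\sigma^{(t)}_{2^A}\bigr\|_{Q(L)\to L_1}=\infty .$$ (ii) Consequently, for every dyadic irrational $t\in[0,1)$, $L\log L$ is the largest Orlicz space on which an estimate of this kind holds: there is an absolute constant $C$ such that for all $t\in[0,1)$, all $n\ge1$ and all $f\in L\log L$ $$E|\widetilde\sigma^{(t)}_nf|\le C\bigl(1+E(|f|\log^+|f|)\bigr);$$ and if $t\in[0,1)$ is a dyadic irrational and $Q$ is a Young function for which there is a constant $C$ with $E|\widetilde\sigma^{(t)}_nf|\le C\,(1+E\,Q(|f|))$ for all $n\ge1$ and all $f\in Q(L)$, then $Q(L)\subseteq L\log L$. 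-/

import Mathlib

open MeasureTheory Filter Topology
open scoped ENNReal NNReal

noncomputable section

namespace DyadicConjugate

/-- The Walsh group `G`: the complete direct product of countably many copies of the cyclic group
of order two. -/
abbrev WalshGroup : Type := ℕ → Fin 2

/-- The normalized Haar measure on `G`: the product of the uniform measures on `{0, 1}`. -/
def walshMeasure : Measure WalshGroup :=
  Measure.infinitePi fun _ : ℕ => ProbabilityTheory.uniformOn (Set.univ : Set (Fin 2))

/-- The `k`-th Rademacher function, `r_k(x) = (-1)^{x_k}`. -/
def rademacher (k : ℕ) (x : WalshGroup) : ℝ := (-1) ^ (x k : ℕ)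

/-- The `m`-th Walsh-Paley function: the product of the `r_k` over the binary digits `k` of `m`
that are equal to one (`m.size` is the number of binary digits of `m`). -/
def walsh (m : ℕ) (x : WalshGroup) : ℝ :=
  ∏ k ∈ Finset.range m.size, if m.testBit k then rademacher k x else 1

/-- The Walsh-Fourier coefficient `E (f w_i)`. -/
def walshCoeff (f : WalshGroup → ℝ) (i : ℕ) : ℝ := ∫ x, f x * walsh i x ∂walshMeasure

/-- Dyadic rationals. -/
def IsDyadicRational (t : ℝ) : Prop := ∃ p n : ℕ, t = (p : ℝ) / 2 ^ n

/-- The sequence `ρ(t)` of the binary digits of `t ∈ [0, 1)`, so that `t = ∑ t_j / 2^(j+1)`; for a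
dyadic rational it is the expansion that terminates in zeros, as
`t_j = ⌊2^(j+1) t⌋ mod 2`. -/
def rho (t : ℝ) : WalshGroup := Real.digits t 2

/-- The multipliers of the conjugate transform: `β_0(t) = r_0(ρ(t))`, and `β_k(t) = r_n(ρ(t))` if
`2^(n-1) ≤ k < 2^n`, that is if `k` has `n` binary digits. -/
def beta (t : ℝ) (k : ℕ) : ℝ := rademacher k.size (rho t)

/-- The `n`-th partial sum of the conjugate transform of `f`. -/
def conjPartialSum (t : ℝ) (n : ℕ) (f : WalshGroup → ℝ) (x : WalshGroup) : ℝ :=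
  ∑ k ∈ Finset.range n, beta t k * walshCoeff f k * walsh k x

/-- The conjugate Fejér means `(1/n) ∑_{k=0}^{n-1} S̃_k f`, for `n ≥ 1`. -/
def conjFejer (t : ℝ) (n : ℕ) (f : WalshGroup → ℝ) (x : WalshGroup) : ℝ :=
  (1 / (n : ℝ)) * ∑ k ∈ Finset.range n, conjPartialSum t k f x

/-- Young functions. -/
structure IsYoungFunction (Q : ℝ → ℝ) : Prop where
  convex : ConvexOn ℝ Set.univ Q
  continuous : Continuous Q
  even : ∀ u, Q (-u) = Q u
  map_zero : Q 0 = 0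
  tendsto_atTop : Tendsto (fun u => Q u / u) atTop atTop
  tendsto_zero : Tendsto (fun u => Q u / u) (𝓝[≠] 0) (𝓝 0)

/-- The modular `E Q(|f|)`, with values in `[0, ∞]`. -/
def modular (Q : ℝ → ℝ) (f : WalshGroup → ℝ) : ℝ≥0∞ :=
  ∫⁻ x, ENNReal.ofReal (Q |f x|) ∂walshMeasure

/-- The Luxemburg norm `inf {k > 0 : E Q(|f| / k) ≤ 1}`, with values in `[0, ∞]`. -/
def orliczNorm (Q : ℝ → ℝ) (f : WalshGroup → ℝ) : ℝ≥0∞ :=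
  ⨅ (k : ℝ≥0) (_ : 0 < k) (_ : modular Q (fun x => f x / k) ≤ 1), (k : ℝ≥0∞)

/-- The Orlicz space `Q(L)`, as a set of (representatives of) measurable functions. -/
def orliczSpace (Q : ℝ → ℝ) : Set (WalshGroup → ℝ) :=
  {f | AEStronglyMeasurable f walshMeasure ∧ orliczNorm Q f < ∞}

/-- The Young function `u log (1 + u)`, `u > 0`, (extended evenly) of the space `L log L`. -/
def llogl (u : ℝ) : ℝ := |u| * Real.log (1 + |u|)

/-- The operator norm of the conjugate Fejér mean of order `n` from `Q(L)` to `L_1`, with values in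
`[0, ∞]`. -/
def conjFejerNorm (t : ℝ) (n : ℕ) (Q : ℝ → ℝ) : ℝ≥0∞ :=
  ⨆ f ∈ {f ∈ orliczSpace Q | orliczNorm Q f ≤ 1}, eLpNorm (conjFejer t n f) 1 walshMeasure

end DyadicConjugate

end

noncomputable section

namespace DyadicConjugate

/-! Since `beta t` is constant on each block `2^m ≤ k < 2^(m+1)`, the conjugate transform multiplies
the dyadic martingale differences by signs.

Upper estimate: the conjugate Fejér mean is a real Walsh multiplier, hence symmetric, and `E|σ̃f|`
equals `E(f · σ̃g)` with `g` the sign of `σ̃f`. The ordinary Fejér mean of `g` is bounded by 2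
(`abs_fejer_le`), and a sign transform of a bounded polynomial has an exponential moment bounded
independently of `t` (`integral_exp_conj_le`). The inequality `ab ≤ a log⁺ a + e^b` turns this into
the `L log L` bound.

Lower estimate: for dyadic irrational `t` both signs recur forever. A product `F` of `N` factors `1
+ r_m` is `2^N` times the indicator of a set of measure `2^(-N)`. Choosing each level so that its
sign opposes the value of the transform already reached on that set gives `E|F̃| ≥ N/2 - 1`
(`exists_walshPoly_conj_large`). Fejér means of order `2^A` of a fixed polynomial converge to its
transform, so uniform boundedness on `Q(L)` passes to `F̃`. Rescaling `F` to height `u`, with `2^N`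
comparable to `Q u`, gives `u log u ≤ C Q(u)` for large `u`, hence `Q(L) ⊆ L log L`. -/

instance : IsProbabilityMeasure walshMeasure := by
  have : ∀ _ : ℕ, IsProbabilityMeasure
      (ProbabilityTheory.uniformOn (Set.univ : Set (Fin 2))) := fun _ =>
    ProbabilityTheory.isProbabilityMeasure_uniformOn Set.finite_univ Set.univ_nonempty
  unfold walshMeasure
  infer_instance

/-! ### Coordinate flips and averaging over them -/

/-- Translation of the Walsh group that changes the `m`-th coordinate. -/
def flip (m : ℕ) (x : WalshGroup) : WalshGroup := fun i => if i = m then x i + 1 else x i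

theorem uniformOn_map_add_one :
    (ProbabilityTheory.uniformOn (Set.univ : Set (Fin 2))).map (fun a => a + 1) =
      ProbabilityTheory.uniformOn (Set.univ : Set (Fin 2)) := by
  ext s hs
  rw [Measure.map_apply (measurable_of_countable _) hs, ProbabilityTheory.uniformOn_univ,
    ProbabilityTheory.uniformOn_univ]
  congr 1
  have h : (fun a : Fin 2 => a + 1) ⁻¹' s = (Equiv.addRight (1 : Fin 2)) ⁻¹' s := rfl
  rw [h, Measure.count_apply hs,
    Measure.count_apply ((measurable_of_countable _) hs)]
  congr 1
  rw [← Equiv.image_symm_eq_preimage]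
  exact (Equiv.injective _).encard_image s

theorem measurePreserving_flip (m : ℕ) :
    MeasurePreserving (flip m) walshMeasure walshMeasure := by
  have : ∀ _ : ℕ, IsProbabilityMeasure
      (ProbabilityTheory.uniformOn (Set.univ : Set (Fin 2))) := fun _ =>
    ProbabilityTheory.isProbabilityMeasure_uniformOn Set.finite_univ Set.univ_nonempty
  have hm : Measurable (flip m) := by
    refine measurable_pi_lambda _ fun i => ?_
    exact (measurable_of_countable (fun a : Fin 2 => if i = m then a + 1 else a)).comp
      (measurable_pi_apply i)
  refine ⟨hm, ?_⟩
  have h := Measure.infinitePi_map_pi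
    (μ := fun _ : ℕ => ProbabilityTheory.uniformOn (Set.univ : Set (Fin 2)))
    (f := fun i a => if i = m then a + 1 else a) (fun i => measurable_of_countable _)
  have e : (fun i : ℕ => (ProbabilityTheory.uniformOn (Set.univ : Set (Fin 2))).map
      (fun a => if i = m then a + 1 else a)) =
      fun _ => ProbabilityTheory.uniformOn (Set.univ : Set (Fin 2)) := by
    funext i
    by_cases hi : i = m
    · simpa [hi] using uniformOn_map_add_one
    · simp [hi]
  rw [e] at h
  exact h

theorem flip_flip (m : ℕ) (x : WalshGroup) : flip m (flip m x) = x := by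
  funext i
  by_cases hi : i = m
  · simp only [flip, hi, if_true]
    generalize x m = a
    revert a; decide
  · simp [flip, hi]

theorem measurableEmbedding_flip (m : ℕ) : MeasurableEmbedding (flip m) :=
  (MeasurableEquiv.mk ⟨flip m, flip m, flip_flip m, flip_flip m⟩
    (measurePreserving_flip m).measurable (measurePreserving_flip m).measurable).measurableEmbedding

theorem integral_flip (m : ℕ) (F : WalshGroup → ℝ) :
    ∫ x, F (flip m x) ∂walshMeasure = ∫ x, F x ∂walshMeasure :=
  (measurePreserving_flip m).integral_comp (measurableEmbedding_flip m) F

theorem integral_eq_zero_of_flip {m : ℕ} {F : WalshGroup → ℝ}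
    (h : ∀ x, F (flip m x) = -F x) : ∫ x, F x ∂walshMeasure = 0 := by
  have := integral_flip m F
  simp_rw [h, integral_neg] at this
  linarith

/-- Averaging a point with its flip replaces conditional expectation: martingale inequalities become
pointwise two-point inequalities. -/
theorem integral_le_of_flip {m : ℕ} {F G : WalshGroup → ℝ} (hF : Integrable F walshMeasure)
    (hG : Integrable G walshMeasure) (h : ∀ x, F x + F (flip m x) ≤ 2 * G x) :
    ∫ x, F x ∂walshMeasure ≤ ∫ x, G x ∂walshMeasure := by
  have hF' : Integrable (fun x => F (flip m x)) walshMeasure :=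
    (measurePreserving_flip m).integrable_comp_of_integrable hF
  have h1 := integral_mono (hF.add hF') (hG.const_mul 2) h
  rw [integral_add' hF hF', integral_flip, integral_const_mul] at h1
  linarith

theorem integral_ge_of_flip {m : ℕ} {F G : WalshGroup → ℝ} (hF : Integrable F walshMeasure)
    (hG : Integrable G walshMeasure) (h : ∀ x, 2 * G x ≤ F x + F (flip m x)) :
    ∫ x, G x ∂walshMeasure ≤ ∫ x, F x ∂walshMeasure := by
  have := integral_le_of_flip (m := m) hF.neg hG.neg (fun x => by
    simp only [Pi.neg_apply]; linarith [h x])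
  simp only [Pi.neg_apply, integral_neg] at this
  linarith

/-! ### Rademacher and Walsh functions, orthonormality -/

theorem rademacher_eq (k : ℕ) (x : WalshGroup) : rademacher k x = 1 ∨ rademacher k x = -1 :=
  neg_one_pow_eq_or ℝ _

theorem rademacher_mul_self (k : ℕ) (x : WalshGroup) : rademacher k x * rademacher k x = 1 := by
  rcases rademacher_eq k x with h | h <;> simp [h]

theorem abs_rademacher (k : ℕ) (x : WalshGroup) : |rademacher k x| = 1 := by
  rcases rademacher_eq k x with h | h <;> simp [h]

theorem rademacher_flip_self (m : ℕ) (x : WalshGroup) :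
    rademacher m (flip m x) = -rademacher m x := by
  simp only [rademacher, flip, if_true]
  generalize x m = a
  fin_cases a <;> simp

theorem rademacher_flip_of_ne {k m : ℕ} (h : k ≠ m) (x : WalshGroup) :
    rademacher k (flip m x) = rademacher k x := by
  simp [rademacher, flip, h]

theorem measurable_rademacher (k : ℕ) : Measurable (rademacher k) :=
  (measurable_of_countable (fun a : Fin 2 => ((-1 : ℝ)) ^ (a : ℕ))).comp (measurable_pi_apply k)

theorem walsh_eq_prod {m n : ℕ} (h : m.size ≤ n) (x : WalshGroup) :
    walsh m x = ∏ k ∈ Finset.range n, if m.testBit k then rademacher k x else 1 := by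
  refine Finset.prod_subset (Finset.range_mono h) fun k _ hk => ?_
  rw [Finset.mem_range, not_lt, Nat.size_le] at hk
  simp [Nat.testBit_lt_two_pow hk]

theorem walsh_zero (x : WalshGroup) : walsh 0 x = 1 := by simp [walsh]

theorem walsh_two_pow_add {m k : ℕ} (h : k < 2 ^ m) (x : WalshGroup) :
    walsh (2 ^ m + k) x = rademacher m x * walsh k x := by
  have hs : (2 ^ m + k).size ≤ m + 1 := Nat.size_le.2 (by rw [pow_succ]; omega)
  rw [walsh_eq_prod hs, walsh_eq_prod (Nat.size_le.2 h), Finset.prod_range_succ, mul_comm]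
  congr 1
  · simp [Nat.testBit_two_pow_add_eq, Nat.testBit_lt_two_pow h]
  · refine Finset.prod_congr rfl fun j hj => ?_
    rw [Nat.testBit_two_pow_add_gt (Finset.mem_range.1 hj)]

theorem size_two_pow_add {m k : ℕ} (h : k < 2 ^ m) : (2 ^ m + k).size = m + 1 :=
  le_antisymm (Nat.size_le.2 (by rw [pow_succ]; omega)) (Nat.lt_size.2 (by omega))

theorem walsh_flip {m k : ℕ} (h : k < 2 ^ m) {j : ℕ} (hj : m ≤ j) (x : WalshGroup) :
    walsh k (flip j x) = walsh k x := by
  rw [walsh_eq_prod (Nat.size_le.2 h), walsh_eq_prod (Nat.size_le.2 h)]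
  refine Finset.prod_congr rfl fun i hi => ?_
  rw [rademacher_flip_of_ne]
  have := Finset.mem_range.1 hi
  omega

theorem abs_walsh (k : ℕ) (x : WalshGroup) : |walsh k x| = 1 := by
  rw [walsh, Finset.abs_prod]
  refine Finset.prod_eq_one fun i _ => ?_
  split_ifs
  · exact abs_rademacher i x
  · simp

theorem measurable_walsh (k : ℕ) : Measurable (walsh k) := by
  refine Finset.measurable_fun_prod _ fun i _ => ?_
  split_ifs
  · exact measurable_rademacher i
  · exact measurable_const

theorem walsh_mul_self (k : ℕ) (x : WalshGroup) : walsh k x * walsh k x = 1 := by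
  rw [← abs_mul_abs_self, abs_walsh, one_mul]

theorem exists_eq_two_pow_add {k : ℕ} (h : k ≠ 0) : ∃ m j, j < 2 ^ m ∧ k = 2 ^ m + j := by
  refine ⟨k.log2, k - 2 ^ k.log2, ?_, ?_⟩
  · have := Nat.lt_log2_self (n := k)
    rw [pow_succ] at this
    have := Nat.two_pow_pos k.log2
    omega
  · have := Nat.log2_self_le h
    omega

/-- Look at the top binary digit of `k`. If `j` lacks it, flipping that coordinate negates the
product; otherwise the common Rademacher factor squares to one and both indices lose the digit. -/
theorem integral_walsh_mul_of_lt {j k : ℕ} (h : j < k) :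
    ∫ x, walsh j x * walsh k x ∂walshMeasure = 0 := by
  obtain ⟨m, i, hi, rfl⟩ := exists_eq_two_pow_add (k := k) (by omega)
  by_cases hj : j < 2 ^ m
  · refine integral_eq_zero_of_flip (m := m) fun x => ?_
    rw [walsh_two_pow_add hi, walsh_two_pow_add hi, walsh_flip hj le_rfl, walsh_flip hi le_rfl,
      rademacher_flip_self]
    ring
  · obtain ⟨l, rfl⟩ := Nat.exists_eq_add_of_le (not_lt.1 hj)
    have hl : l < 2 ^ m := by omega
    simp_rw [walsh_two_pow_add hi, walsh_two_pow_add hl]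
    have e : ∀ x, rademacher m x * walsh l x * (rademacher m x * walsh i x) =
        walsh l x * walsh i x := fun x => by
      linear_combination (walsh l x * walsh i x) * rademacher_mul_self m x
    simp_rw [e]
    exact integral_walsh_mul_of_lt (by omega)
termination_by j
decreasing_by
  have := Nat.two_pow_pos m
  omega

theorem integral_walsh_mul (j k : ℕ) :
    ∫ x, walsh j x * walsh k x ∂walshMeasure = if j = k then 1 else 0 := by
  rcases lt_trichotomy j k with h | h | h
  · rw [integral_walsh_mul_of_lt h, if_neg h.ne]
  · subst h
    simp [walsh_mul_self]
  · simp_rw [mul_comm (walsh j _)]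
    rw [integral_walsh_mul_of_lt h, if_neg h.ne']

/-! ### Walsh polynomials and multipliers -/

/-- Walsh polynomials. -/
def walshPoly (a : ℕ → ℝ) (n : ℕ) (x : WalshGroup) : ℝ := ∑ k ∈ Finset.range n, a k * walsh k x

theorem measurable_walshPoly (a : ℕ → ℝ) (n : ℕ) : Measurable (walshPoly a n) :=
  Finset.measurable_fun_sum _ fun k _ => (measurable_walsh k).const_mul _

theorem abs_walshPoly_le (a : ℕ → ℝ) (n : ℕ) (x : WalshGroup) :
    |walshPoly a n x| ≤ ∑ k ∈ Finset.range n, |a k| := by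
  refine (Finset.abs_sum_le_sum_abs _ _).trans (Finset.sum_le_sum fun k _ => ?_)
  rw [abs_mul, abs_walsh, mul_one]

theorem integrable_of_bounded {F : WalshGroup → ℝ} (hF : Measurable F) {C : ℝ}
    (h : ∀ x, |F x| ≤ C) : Integrable F walshMeasure :=
  Integrable.of_bound hF.aestronglyMeasurable C (ae_of_all _ h)

theorem integrable_walshPoly (a : ℕ → ℝ) (n : ℕ) : Integrable (walshPoly a n) walshMeasure :=
  integrable_of_bounded (measurable_walshPoly a n) (abs_walshPoly_le a n)

theorem integrable_walsh (k : ℕ) : Integrable (walsh k) walshMeasure :=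
  integrable_of_bounded (measurable_walsh k) (fun x => (abs_walsh k x).le)

theorem integrable_mul_walsh {f : WalshGroup → ℝ} (hf : Integrable f walshMeasure) (k : ℕ) :
    Integrable (fun x => f x * walsh k x) walshMeasure :=
  hf.mul_bdd (c := 1) (measurable_walsh k).aestronglyMeasurable
    (ae_of_all _ fun x => (abs_walsh k x).le)

theorem walshPoly_flip (a : ℕ → ℝ) {m n j : ℕ} (hn : n ≤ 2 ^ m) (hj : m ≤ j) (x : WalshGroup) :
    walshPoly a n (flip j x) = walshPoly a n x :=
  Finset.sum_congr rfl fun k hk => by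
    rw [walsh_flip ((Finset.mem_range.1 hk).trans_le hn) hj]

theorem walshPoly_two_pow_add (a : ℕ → ℝ) {m k : ℕ} (hk : k ≤ 2 ^ m) (x : WalshGroup) :
    walshPoly a (2 ^ m + k) x =
      walshPoly a (2 ^ m) x + rademacher m x * walshPoly (fun j => a (2 ^ m + j)) k x := by
  rw [walshPoly, Finset.sum_range_add, walshPoly, walshPoly, Finset.mul_sum]
  congr 1
  refine Finset.sum_congr rfl fun j hj => ?_
  rw [walsh_two_pow_add ((Finset.mem_range.1 hj).trans_le hk)]
  ring

theorem walshPoly_two_pow_succ (a : ℕ → ℝ) (m : ℕ) (x : WalshGroup) :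
    walshPoly a (2 ^ (m + 1)) x =
      walshPoly a (2 ^ m) x + rademacher m x * walshPoly (fun j => a (2 ^ m + j)) (2 ^ m) x := by
  rw [pow_succ, mul_two, walshPoly_two_pow_add a le_rfl]

theorem walshCoeff_walshPoly (a : ℕ → ℝ) (n k : ℕ) :
    walshCoeff (walshPoly a n) k = if k < n then a k else 0 := by
  simp_rw [walshCoeff, walshPoly, Finset.sum_mul]
  rw [integral_finsetSum _ fun j _ => integrable_mul_walsh ((integrable_walsh j).const_mul _) k]
  simp_rw [mul_assoc, integral_const_mul, integral_walsh_mul]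
  simp

theorem integral_mul_walshPoly {f : WalshGroup → ℝ} (hf : Integrable f walshMeasure)
    (a : ℕ → ℝ) (n : ℕ) :
    ∫ x, f x * walshPoly a n x ∂walshMeasure = ∑ k ∈ Finset.range n, a k * walshCoeff f k := by
  simp_rw [walshPoly, Finset.mul_sum, walshCoeff]
  have e : ∀ x k, f x * (a k * walsh k x) = a k * (f x * walsh k x) := fun x k => by ring
  simp_rw [e]
  rw [integral_finsetSum _ fun j _ => (integrable_mul_walsh hf j).const_mul _]
  simp_rw [integral_const_mul]

theorem beta_eq (t : ℝ) (k : ℕ) : beta t k = 1 ∨ beta t k = -1 := rademacher_eq _ _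

theorem abs_beta (t : ℝ) (k : ℕ) : |beta t k| = 1 := abs_rademacher _ _

theorem beta_two_pow_add (t : ℝ) {m k : ℕ} (h : k < 2 ^ m) :
    beta t (2 ^ m + k) = rademacher (m + 1) (rho t) := by
  rw [beta, size_two_pow_add h]

/-- The martingale structure used throughout: all indices of the new block have `m + 1` binary
digits, so the whole difference receives a single sign. -/
theorem walshPoly_beta_two_pow_succ (t : ℝ) (a : ℕ → ℝ) (m : ℕ) (x : WalshGroup) :
    walshPoly (fun k => beta t k * a k) (2 ^ (m + 1)) x =
      walshPoly (fun k => beta t k * a k) (2 ^ m) x + rademacher (m + 1) (rho t) *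
        (rademacher m x * walshPoly (fun j => a (2 ^ m + j)) (2 ^ m) x) := by
  rw [walshPoly_two_pow_succ, mul_left_comm]
  congr 2
  rw [walshPoly, walshPoly, Finset.mul_sum]
  refine Finset.sum_congr rfl fun j hj => ?_
  rw [beta_two_pow_add t (Finset.mem_range.1 hj)]
  ring

theorem sum_range_sum_range (c : ℕ → ℝ) (n : ℕ) :
    ∑ k ∈ Finset.range n, ∑ j ∈ Finset.range k, c j =
      ∑ j ∈ Finset.range n, ((n : ℝ) - 1 - j) * c j := by
  induction n with
  | zero => simp
  | succ n ih =>
    rw [Finset.sum_range_succ, ih, Finset.sum_range_succ, ← Finset.sum_add_distrib]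
    push_cast
    rw [show (n : ℝ) + 1 - 1 - n = 0 by ring, zero_mul, add_zero]
    exact Finset.sum_congr rfl fun j _ => by ring

theorem conjFejer_eq_walshPoly (t : ℝ) (n : ℕ) (f : WalshGroup → ℝ) (x : WalshGroup) :
    conjFejer t n f x =
      walshPoly (fun k => 1 / (n : ℝ) * ((n - 1 - k) * (beta t k * walshCoeff f k))) n x := by
  simp only [conjFejer, conjPartialSum, sum_range_sum_range, walshPoly, Finset.mul_sum]
  exact Finset.sum_congr rfl fun j _ => by ring

/-! ### Dirichlet and Fejér kernels -/

/-- The Dirichlet kernels as functions of two variables. -/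
def dirichletKernel (n : ℕ) (x y : WalshGroup) : ℝ := walshPoly (fun j => walsh j x) n y

/-- The sum of the first `n` Dirichlet kernels. -/
def fejerSum (n : ℕ) (x y : WalshGroup) : ℝ := ∑ k ∈ Finset.range n, dirichletKernel k x y

theorem dirichletKernel_two_pow_add {m k : ℕ} (hk : k ≤ 2 ^ m) (x y : WalshGroup) :
    dirichletKernel (2 ^ m + k) x y = dirichletKernel (2 ^ m) x y +
      rademacher m x * rademacher m y * dirichletKernel k x y := by
  rw [dirichletKernel, walshPoly_two_pow_add _ hk, dirichletKernel]
  congr 1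
  rw [dirichletKernel, walshPoly, walshPoly, Finset.mul_sum, Finset.mul_sum]
  refine Finset.sum_congr rfl fun j hj => ?_
  rw [walsh_two_pow_add ((Finset.mem_range.1 hj).trans_le hk)]
  ring

theorem fejerSum_two_pow_add {m k : ℕ} (hk : k ≤ 2 ^ m) (x y : WalshGroup) :
    fejerSum (2 ^ m + k) x y = fejerSum (2 ^ m) x y + k * dirichletKernel (2 ^ m) x y +
      rademacher m x * rademacher m y * fejerSum k x y := by
  rw [fejerSum, Finset.sum_range_add, fejerSum, fejerSum, Finset.mul_sum, add_assoc]
  congr 1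
  rw [Finset.sum_congr rfl fun j hj => dirichletKernel_two_pow_add
    ((Finset.mem_range.1 hj).le.trans hk) x y, Finset.sum_add_distrib]
  simp

theorem fejerSum_eq_walshPoly (n : ℕ) (x y : WalshGroup) :
    fejerSum n x y = walshPoly (fun j => ((n : ℝ) - 1 - j) * walsh j x) n y := by
  simp only [fejerSum, dirichletKernel, walshPoly, sum_range_sum_range]
  exact Finset.sum_congr rfl fun j _ => by ring

theorem integrable_fejerSum (n : ℕ) (x : WalshGroup) :
    Integrable (fejerSum n x) walshMeasure := by
  have : fejerSum n x = walshPoly (fun j => ((n : ℝ) - 1 - j) * walsh j x) n :=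
    funext (fejerSum_eq_walshPoly n x)
  rw [this]
  exact integrable_walshPoly _ _

theorem fejerSum_flip (m : ℕ) (x y : WalshGroup) :
    fejerSum (2 ^ m) x (flip m y) = fejerSum (2 ^ m) x y := by
  rw [fejerSum_eq_walshPoly, fejerSum_eq_walshPoly, walshPoly_flip _ le_rfl le_rfl]

theorem one_add_rademacher_mul_nonneg (m : ℕ) (x y : WalshGroup) :
    0 ≤ 1 + rademacher m x * rademacher m y := by
  rcases rademacher_eq m x with h | h <;> rcases rademacher_eq m y with h' | h' <;>
    norm_num [h, h']

theorem dirichletKernel_two_pow_nonneg (m : ℕ) (x y : WalshGroup) :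
    0 ≤ dirichletKernel (2 ^ m) x y := by
  induction m with
  | zero => simp [dirichletKernel, walshPoly, walsh_zero]
  | succ m ih =>
    rw [pow_succ, mul_two, dirichletKernel_two_pow_add le_rfl]
    nlinarith [mul_nonneg (one_add_rademacher_mul_nonneg m x y) ih]

theorem integrable_dirichletKernel (n : ℕ) (x : WalshGroup) :
    Integrable (dirichletKernel n x) walshMeasure := integrable_walshPoly _ _

theorem integral_dirichletKernel_two_pow (m : ℕ) (x : WalshGroup) :
    ∫ y, dirichletKernel (2 ^ m) x y ∂walshMeasure = 1 := by
  have h := integral_mul_walshPoly (integrable_walsh 0) (fun j => walsh j x) (2 ^ m)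
  simp_rw [walsh_zero, one_mul] at h
  simp_rw [dirichletKernel, h, walshCoeff, integral_walsh_mul]
  simp [walsh_zero]

/-- Doubling the order multiplies the kernel by a nonnegative factor whose flip average is 1 and
adds `2^m` times a nonnegative kernel of integral 1. -/
theorem integral_abs_fejerSum_two_pow_le (m : ℕ) (x : WalshGroup) :
    ∫ y, |fejerSum (2 ^ m) x y| ∂walshMeasure ≤ 2 ^ m := by
  induction m with
  | zero => simp [fejerSum, dirichletKernel, walshPoly]
  | succ m ih =>
    have h : ∀ y, |fejerSum (2 ^ (m + 1)) x y| ≤ (1 + rademacher m x * rademacher m y) *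
        |fejerSum (2 ^ m) x y| + 2 ^ m * dirichletKernel (2 ^ m) x y := fun y => by
      have h0 : (0 : ℝ) ≤ 2 ^ m * dirichletKernel (2 ^ m) x y :=
        mul_nonneg (by positivity) (dirichletKernel_two_pow_nonneg m x y)
      have e : fejerSum (2 ^ (m + 1)) x y = (1 + rademacher m x * rademacher m y) *
          fejerSum (2 ^ m) x y + 2 ^ m * dirichletKernel (2 ^ m) x y := by
        rw [pow_succ, mul_two, fejerSum_two_pow_add le_rfl]
        push_cast
        ring
      rw [e]
      refine (abs_add_le _ _).trans_eq ?_
      rw [abs_mul, abs_of_nonneg (one_add_rademacher_mul_nonneg m x y), abs_of_nonneg h0]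
    have hG : Integrable (fun y => |fejerSum (2 ^ m) x y| + 2 ^ m * dirichletKernel (2 ^ m) x y)
        walshMeasure :=
      (integrable_fejerSum _ x).abs.add ((integrable_dirichletKernel _ x).const_mul _)
    have h1 := integral_le_of_flip (m := m) (integrable_fejerSum (2 ^ (m + 1)) x).abs hG
      fun y => by
        have a := h y
        have b := h (flip m y)
        have c : dirichletKernel (2 ^ m) x (flip m y) = dirichletKernel (2 ^ m) x y :=
          walshPoly_flip _ le_rfl le_rfl y
        rw [rademacher_flip_self, fejerSum_flip, c] at b
        linarith
    refine h1.trans ?_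
    rw [integral_add (integrable_fejerSum _ x).abs ((integrable_dirichletKernel _ x).const_mul _),
      integral_const_mul, integral_dirichletKernel_two_pow, pow_succ]
    linarith

/-- Removing the top digit of `n = 2^m + k` costs `2^m + k`, and the rest costs at most `2k` by
induction; `k ≤ 2^m` closes the estimate. -/
theorem integral_abs_fejerSum_le (n : ℕ) (x : WalshGroup) :
    ∫ y, |fejerSum n x y| ∂walshMeasure ≤ 2 * n := by
  induction n using Nat.strong_induction_on with
  | _ n ih =>
    rcases eq_or_ne n 0 with rfl | hn
    · simp [fejerSum]
    obtain ⟨m, k, hk, rfl⟩ := exists_eq_two_pow_add hn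
    have hkn : k < 2 ^ m + k := by have := Nat.two_pow_pos m; omega
    have h : ∀ y, |fejerSum (2 ^ m + k) x y| ≤ |fejerSum (2 ^ m) x y| +
        k * dirichletKernel (2 ^ m) x y + |fejerSum k x y| := fun y => by
      rw [fejerSum_two_pow_add hk.le]
      refine (abs_add_three _ _ _).trans_eq ?_
      rw [abs_mul (rademacher m x * _), abs_mul (rademacher m x), abs_rademacher, abs_rademacher,
        abs_of_nonneg (mul_nonneg (Nat.cast_nonneg k) (dirichletKernel_two_pow_nonneg m x y))]
      ring
    have i1 := (integrable_fejerSum (2 ^ m) x).abs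
    have i2 := (integrable_dirichletKernel (2 ^ m) x).const_mul (k : ℝ)
    have i3 := (integrable_fejerSum k x).abs
    have h1 := integral_mono (integrable_fejerSum (2 ^ m + k) x).abs ((i1.add i2).add i3) h
    rw [integral_add' (i1.add i2) i3, integral_add' i1 i2, integral_const_mul,
      integral_dirichletKernel_two_pow] at h1
    have h2 := integral_abs_fejerSum_two_pow_le m x
    have h3 := ih k hkn
    have h4 : (k : ℝ) ≤ 2 ^ m := by exact_mod_cast hk.le
    push_cast
    linarith

theorem abs_fejer_le {g : WalshGroup → ℝ} (hg : Measurable g) (h1 : ∀ x, |g x| ≤ 1) (n : ℕ)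
    (x : WalshGroup) :
    |walshPoly (fun k => ((n : ℝ) - 1 - k) * walshCoeff g k) n x| ≤ 2 * n := by
  have e : walshPoly (fun k => ((n : ℝ) - 1 - k) * walshCoeff g k) n x =
      ∫ y, g y * fejerSum n x y ∂walshMeasure := by
    simp_rw [fejerSum_eq_walshPoly]
    rw [integral_mul_walshPoly (integrable_of_bounded hg h1), walshPoly]
    exact Finset.sum_congr rfl fun j _ => by ring
  rw [e]
  refine (abs_integral_le_integral_abs).trans ((integral_mono ?_ (integrable_fejerSum n x).abs
    fun y => ?_).trans (integral_abs_fejerSum_le n x))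
  · exact ((integrable_fejerSum n x).bdd_mul hg.aestronglyMeasurable (ae_of_all _ h1)).abs
  · simp only [abs_mul]
    exact mul_le_of_le_one_left (abs_nonneg _) (h1 y)

/-! ### Exponential integrability by a Bellman function -/

/-- By `e^q ≤ 1 + q + q^2`, the loss `2s^2` from concavity of `2 - x^2` must absorb at most `s^2/16`
from `q^2` and `s^2/2` from the cross term `4xsq`. The divisor 8 leaves ample room. -/
theorem bellman_step {x s q : ℝ} (h1 : |x + s| ≤ 1) (h2 : |x - s| ≤ 1)
    (hq : q = s / 8 ∨ q = -(s / 8)) :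
    (2 - (x + s) ^ 2) * Real.exp q + (2 - (x - s) ^ 2) * Real.exp (-q) ≤ 2 * (2 - x ^ 2) := by
  rw [abs_le] at h1 h2
  have hs : |s| ≤ 1 := abs_le.2 ⟨by linarith, by linarith⟩
  have hx : |x| ≤ 1 := abs_le.2 ⟨by linarith, by linarith⟩
  have hqa : |q| ≤ 1 := by
    have : |q| = |s| / 8 := by
      rcases hq with rfl | rfl
      · rw [abs_div]; norm_num
      · rw [abs_neg, abs_div]; norm_num
    linarith
  have hqq : q ^ 2 = s ^ 2 / 64 := by rcases hq with rfl | rfl <;> ring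
  have e1 := (abs_le.1 (Real.abs_exp_sub_one_sub_id_le hqa)).2
  have e2 := (abs_le.1 (Real.abs_exp_sub_one_sub_id_le (x := -q) (by rwa [abs_neg]))).2
  have p1 : 0 ≤ 2 - (x + s) ^ 2 := by nlinarith
  have p2 : 0 ≤ 2 - (x - s) ^ 2 := by nlinarith
  have m1 := mul_le_mul_of_nonneg_left (show Real.exp q ≤ 1 + q + q ^ 2 by linarith) p1
  have m2 := mul_le_mul_of_nonneg_left (show Real.exp (-q) ≤ 1 - q + q ^ 2 by nlinarith) p2
  have hc : -(4 * x * s * q) ≤ s ^ 2 / 2 := by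
    rw [abs_le] at hx
    rcases hq with rfl | rfl <;> nlinarith [sq_nonneg s]
  have hx2 : 0 ≤ x ^ 2 * s ^ 2 := by positivity
  have key : (2 - (x + s) ^ 2) * (1 + q + q ^ 2) + (2 - (x - s) ^ 2) * (1 - q + q ^ 2) =
      (4 - 2 * x ^ 2 - 2 * s ^ 2) * (1 + s ^ 2 / 64) - 4 * x * s * q := by
    rw [← hqq]; ring
  nlinarith [sq_nonneg s, sq_nonneg (s ^ 2)]

theorem abs_walshPoly_two_pow_le_of_succ {a : ℕ → ℝ} {m : ℕ} {C : ℝ}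
    (h : ∀ x, |walshPoly a (2 ^ (m + 1)) x| ≤ C) (x : WalshGroup) :
    |walshPoly a (2 ^ m) x| ≤ C := by
  have h1 := h x
  have h2 := h (flip m x)
  rw [walshPoly_two_pow_succ] at h1 h2
  rw [rademacher_flip_self, walshPoly_flip _ le_rfl le_rfl, walshPoly_flip _ le_rfl le_rfl] at h2
  rw [abs_le] at *
  constructor <;> linarith

theorem integrable_bellman (t σ : ℝ) (hσ : σ = 1 ∨ σ = -1) {a : ℕ → ℝ} {m : ℕ}
    (h : ∀ x, |walshPoly a (2 ^ m) x| ≤ 1) :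
    Integrable (fun x => (2 - walshPoly a (2 ^ m) x ^ 2) *
      Real.exp (σ * walshPoly (fun k => beta t k * a k) (2 ^ m) x / 8)) walshMeasure := by
  have mP := measurable_walshPoly a (2 ^ m)
  have mT := measurable_walshPoly (fun k => beta t k * a k) (2 ^ m)
  refine integrable_of_bounded (C := 2 * Real.exp
    (∑ k ∈ Finset.range (2 ^ m), |beta t k * a k|)) (by fun_prop) fun x => ?_
  have h1 := abs_le.1 (h x)
  have h2 := abs_walshPoly_le (fun k => beta t k * a k) (2 ^ m) x
  rw [abs_mul, Real.abs_exp, abs_of_nonneg (by nlinarith)]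
  refine mul_le_mul (by nlinarith) (Real.exp_le_exp.2 ?_) (Real.exp_pos _).le (by norm_num)
  have h3 := abs_nonneg (walshPoly (fun k => beta t k * a k) (2 ^ m) x)
  have h4 := abs_le.1 h2
  rcases hσ with rfl | rfl <;> linarith

/-- The integrand is a supermartingale in `m`: a flip of coordinate `m` changes only the sign of the
new difference, which is the case of `bellman_step`. The 6 is `2 · 3`, from the constant term. -/
theorem integral_bellman_le (t σ : ℝ) (hσ : σ = 1 ∨ σ = -1) (a : ℕ → ℝ) (m : ℕ)
    (h : ∀ x, |walshPoly a (2 ^ m) x| ≤ 1) :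
    ∫ x, (2 - walshPoly a (2 ^ m) x ^ 2) *
      Real.exp (σ * walshPoly (fun k => beta t k * a k) (2 ^ m) x / 8) ∂walshMeasure ≤ 6 := by
  induction m with
  | zero =>
    have h1 := h 0
    simp only [pow_zero, walshPoly, Finset.range_one, Finset.sum_singleton, walsh_zero,
      mul_one] at h1 ⊢
    rw [integral_const]
    simp only [probReal_univ, one_smul]
    have hle : σ * (beta t 0 * a 0) / 8 ≤ 1 := by
      rw [abs_le] at h1
      rcases hσ with rfl | rfl <;> rcases beta_eq t 0 with hb | hb <;> rw [hb] <;> linarith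
    have he := (Real.exp_le_exp.2 hle).trans Real.exp_one_lt_three.le
    nlinarith [Real.exp_pos (σ * (beta t 0 * a 0) / 8), sq_nonneg (a 0)]
  | succ m ih =>
    have hm := abs_walshPoly_two_pow_le_of_succ h
    refine (integral_le_of_flip (m := m) (integrable_bellman t σ hσ h)
      (integrable_bellman t σ hσ hm) fun x => ?_).trans (ih hm)
    have h1 := h x
    have h2 := h (flip m x)
    rw [walshPoly_two_pow_succ] at h1 h2
    simp only [walshPoly_two_pow_succ a, walshPoly_beta_two_pow_succ]
    rw [rademacher_flip_self] at h2 ⊢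
    simp only [walshPoly_flip _ (le_refl (2 ^ m)) (le_refl m)] at h2 ⊢
    generalize walshPoly a (2 ^ m) x = p at *
    generalize walshPoly (fun k => beta t k * a k) (2 ^ m) x = y
    generalize walshPoly (fun j => a (2 ^ m + j)) (2 ^ m) x = d at *
    generalize hs : rademacher m x * d = s at *
    rw [neg_mul, hs] at h2 ⊢
    have hstep := bellman_step (q := σ * rademacher (m + 1) (rho t) * s / 8) h1 h2 (by
      rcases hσ with rfl | rfl <;> rcases rademacher_eq (m + 1) (rho t) with hr | hr <;>
        rw [hr] <;> simp [neg_div])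
    have e1 : σ * (y + rademacher (m + 1) (rho t) * s) / 8 =
        σ * rademacher (m + 1) (rho t) * s / 8 + σ * y / 8 := by ring
    have e2 : σ * (y + rademacher (m + 1) (rho t) * -s) / 8 =
        -(σ * rademacher (m + 1) (rho t) * s / 8) + σ * y / 8 := by ring
    rw [e1, e2, Real.exp_add, Real.exp_add]
    nlinarith [mul_le_mul_of_nonneg_right hstep (Real.exp_pos (σ * y / 8)).le]

/-- The Bellman weight is at least 1 where the polynomial is bounded by 1, and the two signs `σ`
together dominate the absolute value. -/
theorem integral_exp_conj_le (t : ℝ) (a : ℕ → ℝ) (m : ℕ)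
    (h : ∀ x, |walshPoly a (2 ^ m) x| ≤ 1) :
    ∫ x, Real.exp (|walshPoly (fun k => beta t k * a k) (2 ^ m) x| / 8) ∂walshMeasure ≤ 12 := by
  have mP := measurable_walshPoly a (2 ^ m)
  have mT := measurable_walshPoly (fun k => beta t k * a k) (2 ^ m)
  have i1 := integrable_bellman t 1 (Or.inl rfl) h
  have i2 := integrable_bellman t (-1) (Or.inr rfl) h
  have b1 := integral_bellman_le t 1 (Or.inl rfl) a m h
  have b2 := integral_bellman_le t (-1) (Or.inr rfl) a m h
  have hi : Integrable (fun x => Real.exp (|walshPoly (fun k => beta t k * a k) (2 ^ m) x| / 8))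
      walshMeasure := by
    refine integrable_of_bounded (C := Real.exp
      (∑ k ∈ Finset.range (2 ^ m), |beta t k * a k|)) (by fun_prop) fun x => ?_
    rw [Real.abs_exp, Real.exp_le_exp]
    have h2 := abs_walshPoly_le (fun k => beta t k * a k) (2 ^ m) x
    have h3 := abs_nonneg (walshPoly (fun k => beta t k * a k) (2 ^ m) x)
    linarith
  have hm := integral_mono hi (i1.add i2) fun x => ?_
  · rw [integral_add' i1 i2] at hm
    linarith
  · simp only [Pi.add_apply]
    have h1 := abs_le.1 (h x)
    have h2 : 1 ≤ 2 - walshPoly a (2 ^ m) x ^ 2 := by nlinarith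
    have p1 := Real.exp_pos (1 * walshPoly (fun k => beta t k * a k) (2 ^ m) x / 8)
    have p2 := Real.exp_pos (-1 * walshPoly (fun k => beta t k * a k) (2 ^ m) x / 8)
    rcases abs_cases (walshPoly (fun k => beta t k * a k) (2 ^ m) x) with ⟨e, _⟩ | ⟨e, _⟩
    · rw [e]; rw [one_mul] at *; nlinarith
    · rw [e]; rw [neg_one_mul] at *; nlinarith

/-! ### The `L log L` estimate by duality -/

theorem mul_le_mul_posLog_add_exp {a b : ℝ} (ha : 0 ≤ a) :
    a * b ≤ a * Real.posLog a + Real.exp b := by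
  rcases ha.eq_or_lt with rfl | ha
  · simpa using (Real.exp_pos b).le
  have h1 : b - Real.log a ≤ Real.exp (b - Real.log a) := by
    linarith [Real.add_one_le_exp (b - Real.log a)]
  rw [Real.exp_sub, Real.exp_log ha, le_div_iff₀ ha] at h1
  have h2 : Real.log a ≤ Real.posLog a := le_max_right _ _
  nlinarith

/-- Take `g` to be the sign of the mean and move the multiplier from `f` to `g`. -/
theorem integral_abs_conjFejer_eq (t : ℝ) (n : ℕ) {f : WalshGroup → ℝ}
    (hf : Integrable f walshMeasure) :
    ∃ g : WalshGroup → ℝ, Measurable g ∧ (∀ x, |g x| ≤ 1) ∧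
      ∫ x, |conjFejer t n f x| ∂walshMeasure = ∫ x, f x * walshPoly
        (fun k => 1 / (n : ℝ) * ((n - 1 - k) * (beta t k * walshCoeff g k))) n x ∂walshMeasure := by
  set F := walshPoly (fun k => 1 / (n : ℝ) * ((n - 1 - k) * (beta t k * walshCoeff f k))) n
  have hF : ∀ x, conjFejer t n f x = F x := conjFejer_eq_walshPoly t n f
  have mF : Measurable F := measurable_walshPoly _ _
  have mg : Measurable fun x => if 0 ≤ F x then (1 : ℝ) else -1 :=
    Measurable.ite (measurableSet_le measurable_const mF) measurable_const measurable_const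
  have bg : ∀ x, |if 0 ≤ F x then (1 : ℝ) else -1| ≤ 1 := fun x => by split_ifs <;> simp
  refine ⟨fun x => if 0 ≤ F x then 1 else -1, mg, bg, ?_⟩
  have e : ∀ x, |conjFejer t n f x| = (if 0 ≤ F x then 1 else -1) * F x := fun x => by
    rw [hF]
    split_ifs with h
    · rw [abs_of_nonneg h, one_mul]
    · rw [abs_of_neg (not_le.1 h), neg_one_mul]
  simp_rw [e]
  rw [integral_mul_walshPoly (integrable_of_bounded mg bg), integral_mul_walshPoly hf]
  exact Finset.sum_congr rfl fun k _ => by ring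

theorem walshPoly_ite (a : ℕ → ℝ) {n N : ℕ} (h : n ≤ N) (x : WalshGroup) :
    walshPoly (fun k => if k < n then a k else 0) N x = walshPoly a n x := by
  refine (Finset.sum_subset_zero_on_sdiff (Finset.range_mono h) (fun k hk => ?_)
    fun k hk => ?_).symm
  · simp only [Finset.mem_sdiff, Finset.mem_range] at hk
    simp [hk.2]
  · simp [Finset.mem_range.1 hk]

theorem integral_exp_conj_fejer_le (t : ℝ) {n : ℕ} (hn : 1 ≤ n) {g : WalshGroup → ℝ}
    (hg : Measurable g) (h1 : ∀ x, |g x| ≤ 1) :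
    ∫ x, Real.exp (|walshPoly (fun k => 1 / (n : ℝ) *
      ((n - 1 - k) * (beta t k * walshCoeff g k))) n x| / 16) ∂walshMeasure ≤ 12 := by
  have hn' : (0 : ℝ) < n := by exact_mod_cast hn
  set a : ℕ → ℝ := fun k =>
    if k < n then 1 / (2 * (n : ℝ)) * ((n - 1 - k) * walshCoeff g k) else 0 with ha
  -- The exponential estimate concerns complete dyadic blocks, so the coefficients are padded by
  -- zeros up to `2^n`. The `2` in `a` normalizes the Fejér bound to 1 and accounts for 16 in place
  -- of 8.
  have hN : n ≤ 2 ^ n := Nat.lt_two_pow_self.le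
  have hP : ∀ x, |walshPoly a (2 ^ n) x| ≤ 1 := fun x => by
    rw [ha, walshPoly_ite _ hN]
    have : walshPoly (fun k => 1 / (2 * (n : ℝ)) * ((n - 1 - k) * walshCoeff g k)) n x =
        1 / (2 * (n : ℝ)) * walshPoly (fun k => (n - 1 - k) * walshCoeff g k) n x := by
      rw [walshPoly, walshPoly, Finset.mul_sum]
      exact Finset.sum_congr rfl fun k _ => by ring
    rw [this, abs_mul, abs_of_pos (by positivity), div_mul_eq_mul_div, one_mul,
      div_le_one (by positivity)]
    exact abs_fejer_le hg h1 n x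
  convert integral_exp_conj_le t a n hP using 4 with x
  have : walshPoly (fun k => 1 / (n : ℝ) * ((n - 1 - k) * (beta t k * walshCoeff g k))) n x =
      2 * walshPoly (fun k => beta t k * a k) (2 ^ n) x := by
    have : (fun k => beta t k * a k) = fun k => if k < n then
        1 / (2 * (n : ℝ)) * ((n - 1 - k) * (beta t k * walshCoeff g k)) else 0 := by
      funext k
      simp only [ha]
      split_ifs
      · ring
      · simp
    rw [this, walshPoly_ite _ hN, walshPoly, walshPoly, Finset.mul_sum]
    refine Finset.sum_congr rfl fun k _ => ?_
    field_simp
  rw [this, abs_mul, abs_two]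
  ring

theorem eLpNorm_one_eq_ofReal {F : WalshGroup → ℝ} (hF : Integrable F walshMeasure) :
    eLpNorm F 1 walshMeasure = ENNReal.ofReal (∫ x, |F x| ∂walshMeasure) := by
  rw [eLpNorm_one_eq_lintegral_enorm, ofReal_integral_eq_lintegral_ofReal hF.abs
    (ae_of_all _ fun x => abs_nonneg _)]
  exact lintegral_congr fun x => Real.enorm_eq_ofReal_abs _

theorem integrable_conjFejer (t : ℝ) (n : ℕ) (f : WalshGroup → ℝ) :
    Integrable (conjFejer t n f) walshMeasure := by
  rw [show conjFejer t n f = _ from funext (conjFejer_eq_walshPoly t n f)]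
  exact integrable_walshPoly _ _

theorem eLpNorm_conjFejer_le (t : ℝ) {n : ℕ} (hn : 1 ≤ n) {f : WalshGroup → ℝ}
    (hf : Integrable f walshMeasure) :
    eLpNorm (conjFejer t n f) 1 walshMeasure ≤ (192 : ℝ≥0) *
      (1 + ∫⁻ x, ENNReal.ofReal (|f x| * Real.posLog |f x|) ∂walshMeasure) := by
  obtain ⟨g, mg, bg, hg⟩ := integral_abs_conjFejer_eq t n hf
  have hexp := integral_exp_conj_fejer_le t hn mg bg
  rw [eLpNorm_one_eq_ofReal (integrable_conjFejer t n f), hg]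
  set F := walshPoly (fun k => 1 / (n : ℝ) * ((n - 1 - k) * (beta t k * walshCoeff g k))) n
  have mF : Measurable F := measurable_walshPoly _ _
  obtain ⟨B, bF⟩ : ∃ B, ∀ x, |F x| ≤ B := ⟨_, abs_walshPoly_le _ n⟩
  have iE : Integrable (fun x => Real.exp (|F x| / 16)) walshMeasure := by
    refine integrable_of_bounded (by fun_prop) (C := Real.exp B) fun x => ?_
    rw [Real.abs_exp, Real.exp_le_exp]
    exact (div_le_self (abs_nonneg _) (by norm_num)).trans (bF x)
  have iP : Integrable (fun x => f x * F x) walshMeasure :=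
    hf.mul_bdd mF.aestronglyMeasurable (ae_of_all _ bF)
  calc ENNReal.ofReal (∫ x, f x * F x ∂walshMeasure)
      ≤ ENNReal.ofReal (∫ x, |f x * F x| ∂walshMeasure) :=
        ENNReal.ofReal_le_ofReal (integral_mono iP iP.abs fun x => le_abs_self _)
    _ = ∫⁻ x, ENNReal.ofReal |f x * F x| ∂walshMeasure :=
        ofReal_integral_eq_lintegral_ofReal iP.abs (ae_of_all _ fun x => abs_nonneg _)
    _ ≤ ∫⁻ x, (16 * ENNReal.ofReal (Real.exp (|F x| / 16)) +
          16 * ENNReal.ofReal (|f x| * Real.posLog |f x|)) ∂walshMeasure := by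
        refine lintegral_mono fun x => ?_
        have h0 : 0 ≤ |f x| * Real.posLog |f x| :=
          mul_nonneg (abs_nonneg _) Real.posLog_nonneg
        have e : (16 : ℝ≥0∞) = ENNReal.ofReal 16 := by norm_num
        simp only
        rw [e, ← ENNReal.ofReal_mul (by norm_num), ← ENNReal.ofReal_mul (by norm_num),
          ← ENNReal.ofReal_add (by positivity) (by positivity)]
        refine ENNReal.ofReal_le_ofReal ?_
        rw [abs_mul]
        have := mul_le_mul_posLog_add_exp (b := |F x| / 16) (abs_nonneg (f x))
        linarith
    _ = 16 * ENNReal.ofReal (∫ x, Real.exp (|F x| / 16) ∂walshMeasure) +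
          16 * ∫⁻ x, ENNReal.ofReal (|f x| * Real.posLog |f x|) ∂walshMeasure := by
        have m1 : Measurable fun x => ENNReal.ofReal (Real.exp (|F x| / 16)) := by fun_prop
        rw [lintegral_add_left (m1.const_mul _), lintegral_const_mul' _ _ (by norm_num),
          lintegral_const_mul' _ _ (by norm_num),
          ofReal_integral_eq_lintegral_ofReal iE (ae_of_all _ fun x => (Real.exp_pos _).le)]
    -- The second coefficient is enlarged only to share the constant `192 = 16 · 12`.
    _ ≤ 16 * 12 + 16 * 12 * ∫⁻ x, ENNReal.ofReal (|f x| * Real.posLog |f x|) ∂walshMeasure := by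
        refine add_le_add ?_ ?_
        · gcongr
          exact (ENNReal.ofReal_le_ofReal hexp).trans_eq (by norm_num)
        · gcongr
          norm_num
    _ = _ := by
        rw [mul_add, mul_one]
        norm_num

/-! ### Dyadic irrationals and polynomials with large transform -/

/-- A constant tail of digits evaluates to 0 or 1, so `2^n t` is an integer. -/
theorem isDyadicRational_of_digits_eventually_const {t : ℝ} (ht : t ∈ Set.Ico (0 : ℝ) 1) (n : ℕ)
    (d : Fin 2) (h : ∀ i, Real.digits t 2 (i + n) = d) : IsDyadicRational t := by
  have h1 := Real.ofDigits_eq_sum_add_ofDigits (Real.digits t 2) n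
  rw [Real.ofDigits_digits (by norm_num) ht] at h1
  have h2 := Real.ofDigits_digits_sum_eq (b := 2) ht n
  simp_rw [h] at h1
  obtain ⟨c, hc⟩ : ∃ c : ℕ, Real.ofDigits (fun _ : ℕ => d) = c := by
    fin_cases d
    · exact ⟨0, by simp [Real.ofDigits, Real.ofDigitsTerm]⟩
    · exact ⟨1, by simpa using Real.ofDigits_const_last_eq_one 1⟩
  rw [hc] at h1
  have h3 : (2 : ℝ) ^ n ≠ 0 := by positivity
  push_cast at h1 h2
  refine ⟨⌊(2 : ℝ) ^ n * t⌋₊ + c, n, ?_⟩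
  rw [eq_div_iff h3]
  push_cast
  rw [← h2]
  nth_rewrite 1 [h1]
  field_simp

theorem exists_rademacher_rho_eq {t : ℝ} (ht : t ∈ Set.Ico (0 : ℝ) 1) (hd : ¬ IsDyadicRational t)
    {σ : ℝ} (hσ : σ = 1 ∨ σ = -1) (n : ℕ) : ∃ m, n ≤ m ∧ rademacher (m + 1) (rho t) = σ := by
  by_contra! hcon
  refine hd (isDyadicRational_of_digits_eventually_const ht (n + 1) (if σ = 1 then 1 else 0)
    fun i => ?_)
  have := hcon (i + n) (by omega)
  rw [rademacher, rho, add_assoc] at this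
  generalize Real.digits t 2 (i + (n + 1)) = e at this ⊢
  rcases hσ with rfl | rfl <;> fin_cases e <;> simp_all <;> norm_num

/-- The induction carries a potential: the norm of the transform plus the deficit `1 - |v|/2^N`.
Passing from `F` to `F(1 + r_m)` converts the deficit into norm, because `|v + 2^N| + |v - 2^N| ≥ 2
· 2^N`. The sign opposing `v` makes the new deficit at least 1/2, so the potential gains 1/2 per
step. -/
theorem exists_walshPoly_conj_large {t : ℝ} (ht : t ∈ Set.Ico (0 : ℝ) 1)
    (hd : ¬ IsDyadicRational t) (N : ℕ) :
    ∃ (M : ℕ) (a : ℕ → ℝ) (v : ℝ),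
      (∀ x, walshPoly a (2 ^ M) x = 0 ∨ walshPoly a (2 ^ M) x = 2 ^ N) ∧
      (∀ x, walshPoly a (2 ^ M) x ≠ 0 → walshPoly (fun k => beta t k * a k) (2 ^ M) x = v) ∧
      ∫ x, walshPoly a (2 ^ M) x ∂walshMeasure = 1 ∧ |v| ≤ 2 ^ N ∧
      (N : ℝ) / 2 ≤ ∫ x, |walshPoly (fun k => beta t k * a k) (2 ^ M) x| ∂walshMeasure +
        (1 - |v| / 2 ^ N) := by
  induction N with
  | zero =>
    refine ⟨0, fun _ => 1, beta t 0, ?_, ?_, ?_, ?_, ?_⟩ <;>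
      simp [walshPoly, walsh_zero, abs_beta]
  | succ N ih =>
    obtain ⟨M, a, v, hF, hH, hint, hv, hlow⟩ := ih
    set F := walshPoly a (2 ^ M) with hFdef
    set H := walshPoly (fun k => beta t k * a k) (2 ^ M) with hHdef
    obtain ⟨m, hm, hs⟩ := exists_rademacher_rho_eq ht hd
      (σ := if 0 ≤ v then -1 else 1) (by split_ifs <;> simp) M
    have hMm : 2 ^ M ≤ 2 ^ m := Nat.pow_le_pow_right (by norm_num) hm
    set σ : ℝ := if 0 ≤ v then -1 else 1 with hσ
    -- Coefficients of `F(1 + r_m)`: a copy of the spectrum of `F` at 0 and another at `2^m`.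
    -- Truncation is needed since `a` is arbitrary beyond `2^M`.
    let b : ℕ → ℝ := fun k => if k < 2 ^ M then a k else 0
    let a' : ℕ → ℝ := fun k => if k < 2 ^ m then b k else b (k - 2 ^ m)
    have e1 : ∀ x, walshPoly a' (2 ^ m) x = F x := fun x => by
      rw [hFdef, ← walshPoly_ite a hMm]
      exact Finset.sum_congr rfl fun k hk => by simp only [a', Finset.mem_range.1 hk, if_true, b]
    have e2 : ∀ x, walshPoly (fun j => a' (2 ^ m + j)) (2 ^ m) x = F x := fun x => by
      rw [hFdef, ← walshPoly_ite a hMm]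
      exact Finset.sum_congr rfl fun k hk => by simp [a', b]
    have e3 : ∀ x, walshPoly (fun k => beta t k * a' k) (2 ^ m) x = H x := fun x => by
      rw [hHdef, ← walshPoly_ite _ hMm]
      refine Finset.sum_congr rfl fun k hk => ?_
      simp only [a', Finset.mem_range.1 hk, if_true, b]
      split_ifs <;> simp
    have f1 : ∀ x, walshPoly a' (2 ^ (m + 1)) x = F x + rademacher m x * F x := fun x => by
      rw [walshPoly_two_pow_succ, e1, e2]
    have f2 : ∀ x, walshPoly (fun k => beta t k * a' k) (2 ^ (m + 1)) x =
        H x + σ * (rademacher m x * F x) := fun x => by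
      rw [walshPoly_beta_two_pow_succ, e2, e3, hs]
    have hFm : ∀ x, F (flip m x) = F x := walshPoly_flip _ le_rfl hm
    have hHm : ∀ x, H (flip m x) = H x := walshPoly_flip _ le_rfl hm
    have hσv : |v + σ * 2 ^ N| = 2 ^ N - |v| := by
      rw [hσ]
      split_ifs with h0
      · rw [abs_of_nonneg h0] at hv ⊢
        rw [abs_of_nonpos (by linarith)]
        ring
      · rw [abs_of_neg (not_le.1 h0)] at hv ⊢
        rw [abs_of_nonneg (by linarith)]
        ring
    have iF : Integrable F walshMeasure := integrable_walshPoly _ _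
    have iH : Integrable H walshMeasure := integrable_walshPoly _ _
    refine ⟨m + 1, a', v + σ * 2 ^ N, fun x => ?_, fun x hx => ?_, ?_, ?_, ?_⟩
    · rw [f1]
      rcases hF x with h | h <;> rcases rademacher_eq m x with h' | h' <;> rw [h, h']
      · simp
      · simp
      · right; rw [pow_succ]; ring
      · left; ring
    · rw [f1] at hx
      rw [f2]
      rcases hF x with h | h
      · simp [h] at hx
      · rcases rademacher_eq m x with h' | h'
        · rw [hH x (by rw [h]; positivity), h, h', one_mul]
        · exact absurd (by rw [h']; ring) hx
    · simp_rw [f1]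
      have h0 : ∫ x, rademacher m x * F x ∂walshMeasure = 0 :=
        integral_eq_zero_of_flip (m := m) fun x => by
          rw [rademacher_flip_self, hFm]; ring
      have i2 : Integrable (fun x => rademacher m x * F x) walshMeasure :=
        iF.bdd_mul (c := 1) (measurable_rademacher m).aestronglyMeasurable
          (ae_of_all _ fun x => (abs_rademacher m x).le)
      rw [integral_add iF i2, h0, hint, add_zero]
    · rw [hσv, pow_succ]
      linarith [abs_nonneg v, pow_pos (zero_lt_two (α := ℝ)) N]
    · have hpos : (0 : ℝ) < 2 ^ N := by positivity
      have iG : Integrable (fun x => |H x| + (1 - |v| / 2 ^ N) * F x) walshMeasure :=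
        iH.abs.add (iF.const_mul _)
      have key := integral_ge_of_flip (m := m)
        (integrable_walshPoly (fun k => beta t k * a' k) (2 ^ (m + 1))).abs iG fun x => ?_
      · rw [integral_add iH.abs (iF.const_mul _), integral_const_mul, hint, mul_one] at key
        have : 1 / 2 ≤ 1 - |v + σ * 2 ^ N| / 2 ^ (N + 1) := by
          rw [hσv, le_sub_comm, div_le_iff₀ (by positivity), pow_succ]
          linarith [abs_nonneg v]
        push_cast
        linarith
      · simp only [f2, hFm, hHm, rademacher_flip_self]
        have hσ1 : σ = 1 ∨ σ = -1 := by rw [hσ]; split_ifs <;> simp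
        rcases hF x with h | h
        · simp [h]; linarith
        · have hHv := hH x (by rw [h]; positivity)
          have e : (1 - |v| / 2 ^ N) * 2 ^ N = 2 ^ N - |v| := by field_simp
          have g : 2 * 2 ^ N ≤ |v + 2 ^ N| + |v - 2 ^ N| := by
            have g1 := le_abs_self (v + 2 ^ N)
            have g2 := neg_abs_le (v - 2 ^ N)
            linarith
          rw [hHv, h, e]
          rcases hσ1 with h1 | h1 <;> rcases rademacher_eq m x with h2 | h2 <;>
            rw [h1, h2] <;> ring_nf at g ⊢ <;> linarith

/-- For `A ≥ M` the mean differs from the transform by the factor `1 - (k+1)/2^A` on each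
coefficient, a uniform error `O(2^(-A))`. -/
theorem integral_abs_conj_le_of_conjFejer {t : ℝ} {a : ℕ → ℝ} {M : ℕ} {K : ℝ}
    (h : ∀ A, ∫ x, |conjFejer t (2 ^ A) (walshPoly a (2 ^ M)) x| ∂walshMeasure ≤ K) :
    ∫ x, |walshPoly (fun k => beta t k * a k) (2 ^ M) x| ∂walshMeasure ≤ K := by
  set B := ∑ k ∈ Finset.range (2 ^ M), |((k : ℝ) + 1) * (beta t k * a k)|
  have key : ∀ A, M ≤ A →
      ∫ x, |walshPoly (fun k => beta t k * a k) (2 ^ M) x| ∂walshMeasure ≤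
        K + B * (1 / 2) ^ A := fun A hA => by
    have hpt : ∀ x, |walshPoly (fun k => beta t k * a k) (2 ^ M) x| ≤
        |conjFejer t (2 ^ A) (walshPoly a (2 ^ M)) x| + B * (1 / 2) ^ A := fun x => by
      have hMA : 2 ^ M ≤ 2 ^ A := Nat.pow_le_pow_right (by norm_num) hA
      have e : walshPoly (fun k => beta t k * a k) (2 ^ M) x =
          conjFejer t (2 ^ A) (walshPoly a (2 ^ M)) x +
          walshPoly (fun k => ((k : ℝ) + 1) * (beta t k * a k)) (2 ^ M) x * (1 / 2) ^ A := by
        have e' : (fun k : ℕ => 1 / ((2 ^ A : ℕ) : ℝ) * ((((2 ^ A : ℕ) : ℝ) - 1 - k) *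
            (beta t k * walshCoeff (walshPoly a (2 ^ M)) k))) = fun k => if k < 2 ^ M then
            (1 / 2 : ℝ) ^ A * (2 ^ A - 1 - k) * (beta t k * a k) else 0 := by
          funext k
          rw [walshCoeff_walshPoly]
          split_ifs
          · push_cast; rw [one_div_pow]; ring
          · simp
        rw [conjFejer_eq_walshPoly, e', walshPoly_ite _ hMA]
        simp only [walshPoly]
        rw [Finset.sum_mul, ← Finset.sum_add_distrib]
        refine Finset.sum_congr rfl fun k _ => ?_
        have : (1 / 2 : ℝ) ^ A * 2 ^ A = 1 := by rw [← mul_pow]; norm_num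
        linear_combination (-(beta t k * a k * walsh k x)) * this
      rw [e]
      refine (abs_add_le _ _).trans ?_
      rw [abs_mul _ ((1 / 2 : ℝ) ^ A), abs_of_pos (show (0 : ℝ) < (1 / 2) ^ A by positivity)]
      gcongr
      exact abs_walshPoly_le _ _ x
    have i1 := (integrable_conjFejer t (2 ^ A) (walshPoly a (2 ^ M))).abs
    refine (integral_mono (integrable_walshPoly _ _).abs (i1.add (integrable_const _)) hpt).trans ?_
    rw [integral_add' i1 (integrable_const _), integral_const]
    simpa using h A
  have hlim : Tendsto (fun A : ℕ => K + B * (1 / 2 : ℝ) ^ A) atTop (𝓝 (K + B * 0)) :=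
    ((tendsto_pow_atTop_nhds_zero_of_lt_one (by norm_num) (by norm_num)).const_mul _).const_add _
  rw [mul_zero, add_zero] at hlim
  exact ge_of_tendsto hlim (eventually_atTop.2 ⟨M, key⟩)

/-! ### Orlicz spaces -/

theorem IsYoungFunction.nonneg {Q : ℝ → ℝ} (hQ : IsYoungFunction Q) (u : ℝ) : 0 ≤ Q u := by
  have h := hQ.convex.2 (Set.mem_univ u) (Set.mem_univ (-u))
    (show (0 : ℝ) ≤ 1 / 2 by norm_num) (show (0 : ℝ) ≤ 1 / 2 by norm_num) (by norm_num)
  simp only [smul_eq_mul, mul_neg, add_neg_cancel, hQ.map_zero, hQ.even] at h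
  linarith

theorem IsYoungFunction.exists_le {Q : ℝ → ℝ} (hQ : IsYoungFunction Q) :
    ∃ D : ℝ, 0 < D ∧ ∀ u, D ≤ u → u ≤ Q u := by
  obtain ⟨D, hD⟩ := eventually_atTop.1 (hQ.tendsto_atTop.eventually_ge_atTop 1)
  refine ⟨max D 1, by positivity, fun u hu => ?_⟩
  have h := hD u ((le_max_left _ _).trans hu)
  rwa [le_div_iff₀ (zero_lt_one.trans_le ((le_max_right _ _).trans hu)), one_mul] at h

theorem IsYoungFunction.exists_le_add {Q : ℝ → ℝ} (hQ : IsYoungFunction Q) :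
    ∃ D : ℝ, 0 ≤ D ∧ ∀ u, 0 ≤ u → u ≤ Q u + D := by
  obtain ⟨D, hD, h⟩ := hQ.exists_le
  refine ⟨D, hD.le, fun u _ => ?_⟩
  rcases le_total D u with hu | hu
  · linarith [h u hu]
  · linarith [hQ.nonneg u]

theorem llogl_nonneg (u : ℝ) : 0 ≤ llogl u :=
  mul_nonneg (abs_nonneg u) (Real.log_nonneg (by linarith [abs_nonneg u]))

theorem le_llogl_add (u : ℝ) (hu : 0 ≤ u) : u ≤ llogl u + 3 := by
  rcases le_total u 3 with h | h
  · linarith [llogl_nonneg u]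
  · have h1 : 1 ≤ Real.log (1 + u) := by
      rw [Real.le_log_iff_exp_le (by linarith)]
      linarith [Real.exp_one_lt_three]
    rw [llogl, abs_of_nonneg hu]
    nlinarith

theorem exists_modular_le_one {Q : ℝ → ℝ} {f : WalshGroup → ℝ} {c : ℝ≥0∞}
    (h : orliczNorm Q f < c) :
    ∃ k : ℝ≥0, 0 < k ∧ (k : ℝ≥0∞) < c ∧ modular Q (fun x => f x / k) ≤ 1 := by
  simp only [orliczNorm, iInf_lt_iff] at h
  obtain ⟨k, h0, h1, h2⟩ := h
  exact ⟨k, h0, h2, h1⟩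

theorem orliczNorm_le {Q : ℝ → ℝ} {f : WalshGroup → ℝ} {k : ℝ≥0} (hk : 0 < k)
    (h : modular Q (fun x => f x / k) ≤ 1) : orliczNorm Q f ≤ k :=
  iInf_le_of_le k (iInf_le_of_le hk (iInf_le _ h))

/-- Assuming only linear growth of `Q` lets this serve both Young functions and `llogl`, without
checking that the latter is one. -/
theorem integrable_of_modular_le_one {Q : ℝ → ℝ} {D : ℝ} (hD : 0 ≤ D)
    (hQ : ∀ u, 0 ≤ u → u ≤ Q u + D) {f : WalshGroup → ℝ} (hf : AEStronglyMeasurable f walshMeasure)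
    {k : ℝ≥0} (hk : 0 < k) (h : modular Q (fun x => f x / k) ≤ 1) :
    Integrable f walshMeasure ∧ ∫ x, |f x| ∂walshMeasure ≤ k * (1 + D) := by
  have hk' : (0 : ℝ) < k := hk
  have hle : ∫⁻ x, ENNReal.ofReal |f x / k| ∂walshMeasure ≤ ENNReal.ofReal (1 + D) := by
    calc ∫⁻ x, ENNReal.ofReal |f x / k| ∂walshMeasure
        ≤ ∫⁻ x, (ENNReal.ofReal (Q |f x / k|) + ENNReal.ofReal D) ∂walshMeasure :=
          lintegral_mono fun x => (ENNReal.ofReal_le_ofReal (hQ _ (abs_nonneg _))).trans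
            ENNReal.ofReal_add_le
      _ ≤ 1 + ENNReal.ofReal D := by
          rw [lintegral_add_right _ measurable_const, lintegral_const, measure_univ, mul_one]
          gcongr
          exact h
      _ = ENNReal.ofReal (1 + D) := by
          rw [ENNReal.ofReal_add zero_le_one hD, ENNReal.ofReal_one]
  have hfk : AEStronglyMeasurable (fun x => f x / k) walshMeasure := by
    simpa only [div_eq_mul_inv] using hf.mul_const _
  have hi : Integrable (fun x => f x / k) walshMeasure := by
    refine ⟨hfk, ?_⟩
    rw [hasFiniteIntegral_iff_norm]
    exact hle.trans_lt ENNReal.ofReal_lt_top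
  have e : ∀ x, f x = k * (f x / k) := fun x => by field_simp
  refine ⟨(hi.const_mul (k : ℝ)).congr (ae_of_all _ fun x => (e x).symm), ?_⟩
  rw [← ofReal_integral_eq_lintegral_ofReal hi.abs (ae_of_all _ fun x => abs_nonneg _),
    ENNReal.ofReal_le_ofReal_iff (by linarith)] at hle
  calc ∫ x, |f x| ∂walshMeasure = ∫ x, k * |f x / k| ∂walshMeasure := by
        refine integral_congr_ae (ae_of_all _ fun x => ?_)
        simp only [abs_div, abs_of_pos hk']
        field_simp
    _ ≤ _ := by
        rw [integral_const_mul]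
        gcongr

theorem conjFejerNorm_lt_top (t : ℝ) (n : ℕ) {Q : ℝ → ℝ} (hQ : IsYoungFunction Q) :
    conjFejerNorm t n Q < ∞ := by
  obtain ⟨D, hD, hQD⟩ := hQ.exists_le_add
  refine lt_of_le_of_lt (iSup₂_le fun f hf => ?_)
    (ENNReal.ofReal_lt_top (r := n * (2 * (1 + D))))
  obtain ⟨hf, h1⟩ := hf
  -- Taking `k < 2` avoids proving that the infimum in the norm is attained.
  obtain ⟨k, hk, hk2, hm⟩ := exists_modular_le_one (h1.trans_lt ENNReal.one_lt_two)
  obtain ⟨hi, hle⟩ := integrable_of_modular_le_one hD hQD hf.1 hk hm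
  have hk2' : (k : ℝ) ≤ 2 := by
    have : k < 2 := by exact_mod_cast hk2
    exact_mod_cast this.le
  have hle2 : ∫ x, |f x| ∂walshMeasure ≤ 2 * (1 + D) := hle.trans (by gcongr)
  have hc : ∀ j, |walshCoeff f j| ≤ 2 * (1 + D) := fun j => by
    refine (abs_integral_le_integral_abs.trans_eq ?_).trans hle2
    simp_rw [abs_mul, abs_walsh, mul_one]
  have hb : ∀ x, |conjFejer t n f x| ≤ n * (2 * (1 + D)) := fun x => by
    rw [conjFejer_eq_walshPoly]
    refine (abs_walshPoly_le _ _ _).trans ?_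
    refine (Finset.sum_le_card_nsmul _ _ (2 * (1 + D)) fun j hj => ?_).trans_eq (by simp)
    have hj' : (j : ℝ) + 1 ≤ n := by exact_mod_cast Finset.mem_range.1 hj
    have hn : (0 : ℝ) < n := by linarith [Nat.cast_nonneg (α := ℝ) j]
    rw [← mul_assoc, abs_mul, abs_mul (beta t j), abs_beta, one_mul,
      abs_of_nonneg (mul_nonneg (by positivity) (by linarith))]
    refine (mul_le_of_le_one_left (abs_nonneg _) ?_).trans (hc j)
    rw [div_mul_eq_mul_div, one_mul, div_le_one hn]
    linarith [Nat.cast_nonneg (α := ℝ) j]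
  rw [eLpNorm_one_eq_ofReal (integrable_conjFejer t n f)]
  refine ENNReal.ofReal_le_ofReal ((integral_mono (integrable_conjFejer t n f).abs
    (integrable_const _) hb).trans_eq ?_)
  simp

/-- For `v ≥ 2`, `1 + v ≤ v^2` replaces `log (1 + v)` by `2 log v`. Below `w` the constant `llogl w`
suffices, and division by `L` brings the modular below 1. -/
theorem orliczSpace_subset_llogl {Q : ℝ → ℝ} (hQ : ∀ u, 0 ≤ Q u) {C w : ℝ} (hC : 0 ≤ C)
    (hw : 2 ≤ w) (h : ∀ u, w ≤ u → u * Real.log u ≤ C * Q u) :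
    orliczSpace Q ⊆ orliczSpace llogl := by
  intro f hf
  obtain ⟨k, hk, -, hm⟩ := exists_modular_le_one hf.2
  refine ⟨hf.1, ?_⟩
  have hD := llogl_nonneg w
  have hpt : ∀ v, llogl v ≤ 2 * C * Q |v| + llogl w := fun v => by
    rcases le_total |v| w with hv | hv
    · have : llogl v ≤ llogl w := by
        rw [llogl, llogl, abs_of_nonneg (by linarith : 0 ≤ w)]
        refine mul_le_mul hv (Real.log_le_log (by linarith [abs_nonneg v]) (by linarith))
          (Real.log_nonneg (by linarith [abs_nonneg v])) (by linarith)
      have := mul_nonneg hC (hQ |v|)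
      linarith
    · have h1 : Real.log (1 + |v|) ≤ 2 * Real.log |v| := by
        rw [← Real.log_rpow (by linarith), Real.rpow_two]
        exact Real.log_le_log (by linarith) (by nlinarith)
      have h2 := h |v| hv
      rw [llogl]
      nlinarith [abs_nonneg v]
  set L : ℝ≥0 := ⟨2 * C + llogl w + 1, by positivity⟩ with hL
  have hL1 : (1 : ℝ) ≤ L := by change 1 ≤ 2 * C + llogl w + 1; linarith
  have hL0 : (0 : ℝ) < L := by linarith
  have hsc : ∀ v, llogl (v / L) ≤ 2 * C / L * Q |v| + llogl w / L := fun v => by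
    have h1 : llogl (v / L) ≤ llogl v / L := by
      rw [llogl, llogl, abs_div, abs_of_pos hL0, div_mul_eq_mul_div]
      have := abs_nonneg v
      gcongr
      exact div_le_self (abs_nonneg v) hL1
    calc llogl (v / L) ≤ (2 * C * Q |v| + llogl w) / L := h1.trans (by gcongr; exact hpt v)
      _ = _ := by ring
  refine (orliczNorm_le (k := k * L) (mul_pos hk hL0) ?_).trans_lt ENNReal.coe_lt_top
  calc modular llogl (fun x => f x / (k * L : ℝ≥0))
      ≤ ∫⁻ x, (ENNReal.ofReal (2 * C / L) * ENNReal.ofReal (Q |f x / k|) +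
          ENNReal.ofReal (llogl w / L)) ∂walshMeasure := by
        refine lintegral_mono fun x => ?_
        have e : llogl |f x / (k * L : ℝ≥0)| = llogl (f x / k / L) := by
          rw [llogl, llogl, abs_abs, div_div, NNReal.coe_mul]
        simp only
        rw [e, ← ENNReal.ofReal_mul (by positivity), ← ENNReal.ofReal_add
          (mul_nonneg (by positivity) (hQ _)) (by positivity)]
        exact ENNReal.ofReal_le_ofReal (hsc _)
    _ ≤ ENNReal.ofReal (2 * C / L) * 1 + ENNReal.ofReal (llogl w / L) := by
        rw [lintegral_add_right _ measurable_const, lintegral_const, measure_univ, mul_one,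
          lintegral_const_mul' _ _ ENNReal.ofReal_ne_top]
        gcongr
        exact hm
    _ ≤ 1 := by
        rw [mul_one, ← ENNReal.ofReal_add (by positivity) (by positivity), ENNReal.ofReal_le_one,
          ← add_div, div_le_one hL0]
        change _ ≤ 2 * C + llogl w + 1
        linarith

/-! ### Optimality of `L log L` -/

theorem iSup_conjFejerNorm_eq_top {t : ℝ} (ht : t ∈ Set.Ico (0 : ℝ) 1) (hd : ¬ IsDyadicRational t)
    {Q : ℝ → ℝ} (hQ : IsYoungFunction Q) (hsub : ¬ orliczSpace Q ⊆ orliczSpace llogl) :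
    ⨆ A : ℕ, conjFejerNorm t (2 ^ A) Q = ∞ := by
  by_contra hfin
  set K := (⨆ A : ℕ, conjFejerNorm t (2 ^ A) Q).toReal with hK
  have hK0 : 0 ≤ K := ENNReal.toReal_nonneg
  have hbound : ∀ f ∈ orliczSpace Q, orliczNorm Q f ≤ 1 → ∀ A : ℕ,
      ∫ x, |conjFejer t (2 ^ A) f x| ∂walshMeasure ≤ K := fun f hf h1 A => by
    have h2 : eLpNorm (conjFejer t (2 ^ A) f) 1 walshMeasure ≤
        ⨆ A : ℕ, conjFejerNorm t (2 ^ A) Q :=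
      (le_iSup₂_of_le f ⟨hf, h1⟩ le_rfl).trans (le_iSup (fun A : ℕ => conjFejerNorm t (2 ^ A) Q) A)
    rwa [eLpNorm_one_eq_ofReal (integrable_conjFejer _ _ _), ENNReal.ofReal_le_iff_le_toReal hfin]
      at h2
  obtain ⟨D, hD, hQD⟩ := hQ.exists_le
  -- `D` ensures `u ≤ Q u`; `e^4` ensures `log u / 2 - 1 ≥ log u / 4`. This 4 and the 2 in `P ≤ 2 Q
  -- u` give `8K`.
  refine hsub (orliczSpace_subset_llogl hQ.nonneg (C := 8 * K) (w := max D (Real.exp 4))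
    (by positivity) ?_ fun u hu => ?_)
  · refine le_trans ?_ (le_max_right _ _)
    linarith [Real.add_one_le_exp (4 : ℝ)]
  have hu4 : Real.exp 4 ≤ u := (le_max_right _ _).trans hu
  have hu0 : 0 < u := (Real.exp_pos 4).trans_le hu4
  have hlog : 4 ≤ Real.log u := (Real.le_log_iff_exp_le hu0).2 hu4
  have hQu : u ≤ Q u := hQD u ((le_max_left _ _).trans hu)
  have hQ1 : 1 ≤ Q u := by linarith [Real.add_one_le_exp (4 : ℝ)]
  obtain ⟨n, hn1, hn2⟩ := exists_nat_pow_near hQ1 (one_lt_two (α := ℝ))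
  obtain ⟨M, a, v, hF, -, hint, -, hlow⟩ := exists_walshPoly_conj_large ht hd (n + 1)
  obtain ⟨hv, hlow⟩ : 0 ≤ |v| / 2 ^ (n + 1) ∧ _ := ⟨by positivity, hlow⟩
  set P : ℝ := 2 ^ (n + 1) with hP
  have hP0 : 0 < P := by positivity
  -- `f` equals `u` on a set of measure `1/P` and 0 elsewhere, so its modular is `Q u / P ≤ 1`.
  set f := walshPoly (fun k => u / P * a k) (2 ^ M) with hf
  have hfF : ∀ x, f x = u / P * walshPoly a (2 ^ M) x := fun x => by
    rw [hf, walshPoly, walshPoly, Finset.mul_sum]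
    exact Finset.sum_congr rfl fun k _ => by ring
  have hmod : modular Q (fun x => f x / (1 : ℝ≥0)) ≤ 1 := by
    have e : ∀ x, Q |f x / (1 : ℝ≥0)| = Q u / P * walshPoly a (2 ^ M) x := fun x => by
      rw [NNReal.coe_one, div_one, hfF]
      rcases hF x with h | h <;> rw [h]
      · simp [hQ.map_zero]
      · rw [div_mul_cancel₀ _ hP0.ne', div_mul_cancel₀ _ hP0.ne', abs_of_pos hu0]
    have hF0 : ∀ x, 0 ≤ Q u / P * walshPoly a (2 ^ M) x := fun x => by
      refine mul_nonneg (by positivity) ?_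
      rcases hF x with h | h <;> rw [h]
      positivity
    rw [modular]
    simp_rw [e]
    rw [← ofReal_integral_eq_lintegral_ofReal ((integrable_walshPoly _ _).const_mul _)
      (ae_of_all _ hF0), integral_const_mul, hint, mul_one, ENNReal.ofReal_le_one, div_le_one hP0]
    exact hn2.le
  have hnorm : orliczNorm Q f ≤ 1 := orliczNorm_le one_pos hmod
  have hmem : f ∈ orliczSpace Q :=
    ⟨(measurable_walshPoly _ _).aestronglyMeasurable, hnorm.trans_lt ENNReal.one_lt_top⟩
  have hT := integral_abs_conj_le_of_conjFejer (hbound f hmem hnorm)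
  have e2 : ∀ x, |walshPoly (fun k => beta t k * (u / P * a k)) (2 ^ M) x| =
      u / P * |walshPoly (fun k => beta t k * a k) (2 ^ M) x| := fun x => by
    rw [← abs_of_pos (div_pos hu0 hP0), ← abs_mul, abs_of_pos (div_pos hu0 hP0)]
    congr 1
    rw [walshPoly, walshPoly, Finset.mul_sum]
    exact Finset.sum_congr rfl fun k _ => by ring
  simp_rw [e2] at hT
  rw [integral_const_mul, div_mul_eq_mul_div, div_le_iff₀ hP0] at hT
  have hlogn : Real.log u ≤ n + 1 := by
    have h1 := Real.log_le_log hu0 (hQu.trans hn2.le)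
    rw [hP, Real.log_pow] at h1
    push_cast at h1
    nlinarith [Real.log_two_lt_d9, Nat.cast_nonneg (α := ℝ) n]
  have hP2 : P ≤ 2 * Q u := by rw [hP, pow_succ]; linarith
  push_cast at hlow
  have h3 : Real.log u / 4 ≤
      ∫ x, |walshPoly (fun k => beta t k * a k) (2 ^ M) x| ∂walshMeasure := by linarith
  have h4 := mul_le_mul_of_nonneg_left h3 hu0.le
  have h5 := mul_le_mul_of_nonneg_left hP2 hK0
  linarith

theorem conjFejer_const_mul (t : ℝ) (n : ℕ) (c : ℝ) (f : WalshGroup → ℝ) (x : WalshGroup) :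
    conjFejer t n (fun y => c * f y) x = c * conjFejer t n f x := by
  have : ∀ k, walshCoeff (fun y => c * f y) k = c * walshCoeff f k := fun k => by
    simp_rw [walshCoeff, mul_assoc, integral_const_mul]
  rw [conjFejer_eq_walshPoly, conjFejer_eq_walshPoly, walshPoly, walshPoly, Finset.mul_sum]
  exact Finset.sum_congr rfl fun k _ => by rw [this]; ring

/-- Homogeneity turns a modular estimate into a norm estimate: apply it to `f / k` with `k < 2` and
modular at most 1. -/
theorem conjFejerNorm_le_of_modular {t : ℝ} {n : ℕ} {Q : ℝ → ℝ} {C : ℝ≥0}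
    (h : ∀ f ∈ orliczSpace Q, eLpNorm (conjFejer t n f) 1 walshMeasure ≤ C * (1 + modular Q f)) :
    conjFejerNorm t n Q ≤ 2 * (C * 2) := by
  refine iSup₂_le fun f hf => ?_
  obtain ⟨hf, h1⟩ := hf
  obtain ⟨k, hk, hk2, hm⟩ := exists_modular_le_one (h1.trans_lt ENNReal.one_lt_two)
  have hk' : (k : ℝ) ≠ 0 := by exact_mod_cast hk.ne'
  have hg : (fun x => f x / k) ∈ orliczSpace Q := by
    refine ⟨by simpa only [div_eq_mul_inv] using hf.1.mul_const _, ?_⟩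
    exact (orliczNorm_le one_pos (by simpa using hm)).trans_lt ENNReal.coe_lt_top
  have e : conjFejer t n f = (k : ℝ) • conjFejer t n (fun x => f x / k) := by
    funext x
    rw [Pi.smul_apply, smul_eq_mul, ← conjFejer_const_mul]
    congr 1
    funext y
    field_simp
  rw [e, eLpNorm_const_smul]
  have hke : ‖(k : ℝ)‖ₑ = k := by simp
  rw [hke]
  refine mul_le_mul' hk2.le ((h _ hg).trans ?_)
  gcongr
  calc 1 + modular Q (fun x => f x / k) ≤ 1 + 1 := by gcongr
    _ = 2 := one_add_one_eq_two

end DyadicConjugate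

end

theorem theorem3 :
    -- for `t` dyadic irrational and `Q(L)` not contained in `L log L`, the operators are bounded
    -- from `Q(L)` to `L_1`, but not uniformly
    (∀ t ∈ Set.Ico (0 : ℝ) 1, ¬ DyadicConjugate.IsDyadicRational t →
      ∀ Q : ℝ → ℝ, DyadicConjugate.IsYoungFunction Q →
        ¬ DyadicConjugate.orliczSpace Q ⊆ DyadicConjugate.orliczSpace DyadicConjugate.llogl →
          (∀ A : ℕ, DyadicConjugate.conjFejerNorm t (2 ^ A) Q < ∞) ∧
          (⨆ A : ℕ, DyadicConjugate.conjFejerNorm t (2 ^ A) Q) = ∞) ∧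
    -- the estimate holds on `L log L`, with an absolute constant
    (∃ C : ℝ≥0, ∀ t ∈ Set.Ico (0 : ℝ) 1, ∀ n : ℕ, 1 ≤ n →
      ∀ f ∈ DyadicConjugate.orliczSpace DyadicConjugate.llogl,
        eLpNorm (DyadicConjugate.conjFejer t n f) 1 DyadicConjugate.walshMeasure ≤
          C * (1 + ∫⁻ x, ENNReal.ofReal (|f x| * Real.posLog |f x|)
            ∂DyadicConjugate.walshMeasure)) ∧
    -- every Orlicz space on which an estimate of this kind holds is contained in `L log L`
    (∀ t ∈ Set.Ico (0 : ℝ) 1, ¬ DyadicConjugate.IsDyadicRational t →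
      ∀ Q : ℝ → ℝ, DyadicConjugate.IsYoungFunction Q →
        (∃ C : ℝ≥0, ∀ n : ℕ, 1 ≤ n → ∀ f ∈ DyadicConjugate.orliczSpace Q,
          eLpNorm (DyadicConjugate.conjFejer t n f) 1 DyadicConjugate.walshMeasure ≤
            C * (1 + DyadicConjugate.modular Q f)) →
        DyadicConjugate.orliczSpace Q ⊆
          DyadicConjugate.orliczSpace DyadicConjugate.llogl) := by
  open DyadicConjugate in
  refine ⟨fun t ht hd Q hQ hsub => ⟨fun A => conjFejerNorm_lt_top t _ hQ,
    iSup_conjFejerNorm_eq_top ht hd hQ hsub⟩, ⟨192, fun t _ n hn f hf => ?_⟩,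
    fun t ht hd Q hQ ⟨C, hC⟩ => ?_⟩
  · obtain ⟨k, hk, -, hm⟩ := exists_modular_le_one hf.2
    exact eLpNorm_conjFejer_le t hn
      (integrable_of_modular_le_one (by norm_num) le_llogl_add hf.1 hk hm).1
  · by_contra hsub
    have h := iSup_conjFejerNorm_eq_top ht hd hQ hsub
    have hle : ⨆ A : ℕ, conjFejerNorm t (2 ^ A) Q ≤ 2 * (C * 2) :=
      iSup_le fun A => conjFejerNorm_le_of_modular (hC (2 ^ A) Nat.one_le_two_pow)
    rw [h, top_le_iff] at hle
    exact absurd hle (ENNReal.mul_ne_top (by norm_num)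
      (ENNReal.mul_ne_top ENNReal.coe_ne_top (by norm_num)))
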